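/- Let $X$ be a compact Hausdorff extremally disconnected topological space (the closure of every open set is open), and let $\mathbb{C}\cup\{\infty\}$ be the one-point compactification of $\mathbb{C}$. Let $C^+(X)$ be the set of continuous functions $f:X\to\mathbb{C}\cup\{\infty\}$ such that the closed set $f^{-1}[\{\infty\}]$ is nowhere dense in $X$. It is a commutative ring in which $f+g$ (respectively $f\cdot g$) is the unique $h\in C^+(X)$ such that $h(x)=f(x)+g(x)$ (respectively $h(x)=f(x)g(x)$) for all $x\in X$ with $f(x),g(x)\in\mathbb{C}$, and in which $0$ and $1$ are the constant functions. For $p\in X$ let $C^+(X)/p$ be the ring of germs at $p$, that is, the quotient ring of $C^+(X)$ in which $f$ and $g$ are identified if and only if $f\restriction U=g\restriction U$ for some open neighbourhood $U$ of $p$. Then for every $p\in X$ the ring $C^+(X)/p$ is an algebraically closed field. -/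

import Mathlib

open scoped Topology OnePoint

/-- `C⁺(X)`: the continuous functions `f : X → ℂ ∪ {∞}` into the one point compactification of `ℂ`
such that the preimage of `∞` (automatically closed, by continuity) is nowhere dense. -/
structure CPlus (X : Type*) [TopologicalSpace X] where
  toMap : C(X, OnePoint ℂ)
  nowhereDense_infty : IsNowhereDense (toMap ⁻¹' {(∞ : OnePoint ℂ)})

namespace CPlus

section Basic

variable {X : Type*} [TopologicalSpace X]

noncomputable instance : CoeFun (CPlus X) (fun _ => X → OnePoint ℂ) := ⟨fun f => f.toMap⟩

theorem cont (f : CPlus X) : Continuous (f : X → OnePoint ℂ) := f.toMap.continuous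

theorem ext' {f g : CPlus X} (h : ∀ x, f x = g x) : f = g := by
  cases f
  cases g
  congr 1
  exact ContinuousMap.ext h

/-- The set of points at which `f` is finite. -/
def finSet (f : CPlus X) : Set X := {x | f x ≠ ∞}

theorem isOpen_finSet (f : CPlus X) : IsOpen f.finSet :=
  (isClosed_singleton.preimage f.cont).isOpen_compl

theorem dense_finSet (f : CPlus X) : Dense f.finSet := by
  have h := f.nowhereDense_infty
  rw [(isClosed_singleton.preimage f.cont).isNowhereDense_iff] at h
  exact interior_eq_empty_iff_dense_compl.1 h

/-- Two elements of `C⁺(X)` that agree on a dense subset of an open set agree on that open set. -/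
theorem eqOn_of_dense {f g : CPlus X} {U D : Set X} (hU : IsOpen U) (hD : Dense D)
    (h : ∀ x ∈ U ∩ D, f x = g x) : ∀ x ∈ U, f x = g x := by
  intro x hx
  have hcl : IsClosed {x | f x = g x} := isClosed_eq f.cont g.cont
  exact hcl.closure_subset_iff.2 h (hD.open_subset_closure_inter hU hx)

theorem ext_of_dense {f g : CPlus X} {D : Set X} (hD : Dense D)
    (h : ∀ x ∈ D, f x = g x) : f = g :=
  ext' fun x => eqOn_of_dense isOpen_univ hD (fun y hy => h y hy.2) x trivial

theorem dense_finSet₂ (f g : CPlus X) : Dense (f.finSet ∩ g.finSet) :=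
  f.dense_finSet.inter_of_isOpen_left g.dense_finSet f.isOpen_finSet

theorem dense_finSet₃ (f g h : CPlus X) : Dense ((f.finSet ∩ g.finSet) ∩ h.finSet) :=
  (dense_finSet₂ f g).inter_of_isOpen_left h.dense_finSet (f.isOpen_finSet.inter g.isOpen_finSet)

theorem exists_of_mem_finSet {f : CPlus X} {x : X} (hx : x ∈ f.finSet) :
    ∃ a : ℂ, f x = (a : OnePoint ℂ) :=
  (OnePoint.ne_infty_iff_exists.1 hx).imp fun _ h => h.symm

/-- The constant functions. -/
noncomputable def const (X : Type*) [TopologicalSpace X] (c : ℂ) : CPlus X where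
  toMap := ContinuousMap.const X (c : OnePoint ℂ)
  nowhereDense_infty := by
    have : (ContinuousMap.const X (c : OnePoint ℂ)) ⁻¹' {(∞ : OnePoint ℂ)} = ∅ := by
      ext x
      simp
    rw [this]
    exact isNowhereDense_empty

@[simp] theorem const_apply (c : ℂ) (x : X) : const X c x = (c : OnePoint ℂ) := rfl

/-- The zero of `C⁺(X)` is the constant function `0`. -/
noncomputable instance : Zero (CPlus X) := ⟨const X 0⟩

/-- The one of `C⁺(X)` is the constant function `1`. -/
noncomputable instance : One (CPlus X) := ⟨const X 1⟩

theorem zero_apply (x : X) : (0 : CPlus X) x = ((0 : ℂ) : OnePoint ℂ) := rfl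

theorem one_apply (x : X) : (1 : CPlus X) x = ((1 : ℂ) : OnePoint ℂ) := rfl

end Basic

section Ring

variable {X : Type*} [TopologicalSpace X] [CompactSpace X] [T2Space X] [ExtremallyDisconnected X]

/-- For a continuous operation on `ℂ`, there is exactly one element of `C⁺(X)` which is given by
the pointwise operation at all points where both arguments are finite. -/
theorem existsUnique_lift (op : ℂ → ℂ → ℂ) (hop : Continuous fun q : ℂ × ℂ => op q.1 q.2)
    (f g : CPlus X) : ∃! h : CPlus X, ∀ (x : X) (a b : ℂ),
      f x = (a : OnePoint ℂ) → g x = (b : OnePoint ℂ) → h x = (op a b : ℂ) := by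
  classical
  let val : CPlus X → X → ℂ := fun f x => (f x).elim 0 id
  have hval : ∀ (f : CPlus X) (x : X) (a : ℂ), f x = (a : OnePoint ℂ) → val f x = a := by
    intro f x a h
    simp [val, h]
  have hvalc : ∀ (f : CPlus X), ∀ x ∈ f.finSet, ContinuousAt (val f) x := by
    intro f x hx
    rw [OnePoint.isOpenEmbedding_coe.isInducing.continuousAt_iff]
    refine f.cont.continuousAt.congr ?_
    filter_upwards [f.isOpen_finSet.mem_nhds hx] with y hy
    obtain ⟨a, ha⟩ := exists_of_mem_finSet hy
    simp [hval f y a ha, ha]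
  let D : Set X := f.finSet ∩ g.finSet
  have hD : Dense D := dense_finSet₂ f g
  let F : X → OnePoint ℂ := fun x => (op (val f x) (val g x) : ℂ)
  have hF : ∀ x ∈ D, ContinuousAt F x := fun x hx =>
    OnePoint.continuous_coe.continuousAt.comp
      (hop.continuousAt.comp ((hvalc f x hx.1).prodMk (hvalc g x hx.2)))
  let S : Set (X × OnePoint ℂ) := {q | q.1 ∈ D ∧ q.2 = F q.1}
  have hS : ∀ q ∈ closure S, q.1 ∈ D → q.2 = F q.1 := by
    intro q hq hqD
    have : (𝓝[S] q).NeBot := mem_closure_iff_nhdsWithin_neBot.1 hq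
    have h1 : Filter.Tendsto (fun r : X × OnePoint ℂ => F r.1) (𝓝[S] q) (𝓝 (F q.1)) :=
      ((hF q.1 hqD).tendsto.comp continuous_fst.continuousAt).mono_left nhdsWithin_le_nhds
    have h2 : Filter.Tendsto (fun r : X × OnePoint ℂ => r.2) (𝓝[S] q) (𝓝 q.2) :=
      continuous_snd.continuousAt.tendsto.mono_left nhdsWithin_le_nhds
    refine tendsto_nhds_unique (h2.congr' ?_) h1
    filter_upwards [self_mem_nhdsWithin] with r hr using hr.2
  have hcomp : CompactSpace (closure S) := isCompact_iff_compactSpace.1 isClosed_closure.isCompact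
  have hsurj : Function.Surjective fun q : closure S => q.1.1 := by
    have hr : IsClosed (Set.range fun q : closure S => q.1.1) :=
      (isCompact_range (continuous_fst.comp continuous_subtype_val)).isClosed
    have : D ⊆ Set.range fun q : closure S => q.1.1 := fun x hx =>
      ⟨⟨(x, F x), subset_closure ⟨hx, rfl⟩⟩, rfl⟩
    intro x
    exact hr.closure_subset_iff.2 this (hD x)
  obtain ⟨s, hsc, hs⟩ := CompactT2.ExtremallyDisconnected.projective (A := X)
    (continuous_id) (continuous_fst.comp continuous_subtype_val) hsurj
  have hs' : ∀ x, (s x).1.1 = x := fun x => congrFun hs x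
  let m : C(X, OnePoint ℂ) := ⟨fun x => (s x).1.2, by fun_prop⟩
  have hm : ∀ x ∈ D, m x = F x := by
    intro x hx
    have := hS (s x).1 (s x).2 (by rw [hs']; exact hx)
    rwa [hs'] at this
  have hnd : IsNowhereDense (m ⁻¹' {(∞ : OnePoint ℂ)}) := by
    rw [(isClosed_singleton.preimage m.continuous).isNowhereDense_iff,
      interior_eq_empty_iff_dense_compl]
    refine hD.mono fun x hx hx' => ?_
    have h1 : m x = ∞ := hx'
    rw [hm x hx] at h1
    exact OnePoint.coe_ne_infty _ h1
  refine ⟨⟨m, hnd⟩, ?_, ?_⟩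
  · intro x a b ha hb
    have hx : x ∈ D := ⟨by simp [finSet, ha], by simp [finSet, hb]⟩
    refine (hm x hx).trans ?_
    simp only [F, hval f x a ha, hval g x b hb]
  · intro k hk
    refine ext_of_dense hD fun x hx => ?_
    obtain ⟨a, ha⟩ := exists_of_mem_finSet hx.1
    obtain ⟨b, hb⟩ := exists_of_mem_finSet hx.2
    rw [hk x a b ha hb]
    refine Eq.trans ?_ (hm x hx).symm
    simp only [F, hval f x a ha, hval g x b hb]

theorem existsUnique_add (f g : CPlus X) : ∃! h : CPlus X, ∀ (x : X) (a b : ℂ),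
    f x = (a : OnePoint ℂ) → g x = (b : OnePoint ℂ) → h x = (a + b : ℂ) :=
  existsUnique_lift (fun a b => a + b) (by fun_prop) f g

theorem existsUnique_mul (f g : CPlus X) : ∃! h : CPlus X, ∀ (x : X) (a b : ℂ),
    f x = (a : OnePoint ℂ) → g x = (b : OnePoint ℂ) → h x = (a * b : ℂ) :=
  existsUnique_lift (fun a b => a * b) (by fun_prop) f g

/-- `f + g` is the unique element of `C⁺(X)` whose value at `x` is `f x + g x` whenever both
`f x` and `g x` are finite. -/
noncomputable instance : Add (CPlus X) := ⟨fun f g => (existsUnique_add f g).choose⟩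

/-- `f * g` is the unique element of `C⁺(X)` whose value at `x` is `f x * g x` whenever both
`f x` and `g x` are finite. -/
noncomputable instance : Mul (CPlus X) := ⟨fun f g => (existsUnique_mul f g).choose⟩

noncomputable instance : Neg (CPlus X) := ⟨fun f => const X (-1) * f⟩

theorem add_apply {f g : CPlus X} {x : X} {a b : ℂ} (ha : f x = (a : OnePoint ℂ))
    (hb : g x = (b : OnePoint ℂ)) : (f + g) x = (a + b : ℂ) :=
  (existsUnique_add f g).choose_spec.1 x a b ha hb

theorem mul_apply {f g : CPlus X} {x : X} {a b : ℂ} (ha : f x = (a : OnePoint ℂ))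
    (hb : g x = (b : OnePoint ℂ)) : (f * g) x = (a * b : ℂ) :=
  (existsUnique_mul f g).choose_spec.1 x a b ha hb

theorem neg_apply {f : CPlus X} {x : X} {a : ℂ} (ha : f x = (a : OnePoint ℂ)) :
    (-f) x = ((-a : ℂ) : OnePoint ℂ) :=
  (mul_apply (const_apply (-1) x) ha).trans (by rw [neg_one_mul])

/-- `C⁺(X)` is a commutative ring. -/
noncomputable instance : CommRing (CPlus X) where
  add_assoc f g h := ext_of_dense (dense_finSet₃ f g h) fun x hx => by
    obtain ⟨a, ha⟩ := exists_of_mem_finSet hx.1.1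
    obtain ⟨b, hb⟩ := exists_of_mem_finSet hx.1.2
    obtain ⟨c, hc⟩ := exists_of_mem_finSet hx.2
    rw [add_apply (add_apply ha hb) hc, add_apply ha (add_apply hb hc), add_assoc]
  zero_add f := ext_of_dense f.dense_finSet fun x hx => by
    obtain ⟨a, ha⟩ := exists_of_mem_finSet hx
    rw [add_apply (zero_apply x) ha, ha, zero_add]
  add_zero f := ext_of_dense f.dense_finSet fun x hx => by
    obtain ⟨a, ha⟩ := exists_of_mem_finSet hx
    rw [add_apply ha (zero_apply x), ha, add_zero]
  add_comm f g := ext_of_dense (dense_finSet₂ f g) fun x hx => by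
    obtain ⟨a, ha⟩ := exists_of_mem_finSet hx.1
    obtain ⟨b, hb⟩ := exists_of_mem_finSet hx.2
    rw [add_apply ha hb, add_apply hb ha, add_comm]
  left_distrib f g h := ext_of_dense (dense_finSet₃ f g h) fun x hx => by
    obtain ⟨a, ha⟩ := exists_of_mem_finSet hx.1.1
    obtain ⟨b, hb⟩ := exists_of_mem_finSet hx.1.2
    obtain ⟨c, hc⟩ := exists_of_mem_finSet hx.2
    rw [mul_apply ha (add_apply hb hc), add_apply (mul_apply ha hb) (mul_apply ha hc), mul_add]
  right_distrib f g h := ext_of_dense (dense_finSet₃ f g h) fun x hx => by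
    obtain ⟨a, ha⟩ := exists_of_mem_finSet hx.1.1
    obtain ⟨b, hb⟩ := exists_of_mem_finSet hx.1.2
    obtain ⟨c, hc⟩ := exists_of_mem_finSet hx.2
    rw [mul_apply (add_apply ha hb) hc, add_apply (mul_apply ha hc) (mul_apply hb hc), add_mul]
  zero_mul f := ext_of_dense f.dense_finSet fun x hx => by
    obtain ⟨a, ha⟩ := exists_of_mem_finSet hx
    rw [mul_apply (zero_apply x) ha, zero_apply, zero_mul]
  mul_zero f := ext_of_dense f.dense_finSet fun x hx => by
    obtain ⟨a, ha⟩ := exists_of_mem_finSet hx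
    rw [mul_apply ha (zero_apply x), zero_apply, mul_zero]
  mul_assoc f g h := ext_of_dense (dense_finSet₃ f g h) fun x hx => by
    obtain ⟨a, ha⟩ := exists_of_mem_finSet hx.1.1
    obtain ⟨b, hb⟩ := exists_of_mem_finSet hx.1.2
    obtain ⟨c, hc⟩ := exists_of_mem_finSet hx.2
    rw [mul_apply (mul_apply ha hb) hc, mul_apply ha (mul_apply hb hc), mul_assoc]
  one_mul f := ext_of_dense f.dense_finSet fun x hx => by
    obtain ⟨a, ha⟩ := exists_of_mem_finSet hx
    rw [mul_apply (one_apply x) ha, ha, one_mul]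
  mul_one f := ext_of_dense f.dense_finSet fun x hx => by
    obtain ⟨a, ha⟩ := exists_of_mem_finSet hx
    rw [mul_apply ha (one_apply x), ha, mul_one]
  mul_comm f g := ext_of_dense (dense_finSet₂ f g) fun x hx => by
    obtain ⟨a, ha⟩ := exists_of_mem_finSet hx.1
    obtain ⟨b, hb⟩ := exists_of_mem_finSet hx.2
    rw [mul_apply ha hb, mul_apply hb ha, mul_comm]
  neg_add_cancel f := ext_of_dense f.dense_finSet fun x hx => by
    obtain ⟨a, ha⟩ := exists_of_mem_finSet hx
    rw [add_apply (neg_apply ha) ha, zero_apply, neg_add_cancel]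
  nsmul := nsmulRec
  zsmul := zsmulRec

/-- The congruence on `C⁺(X)` of having the same germ at `p`: `f` and `g` are identified when they
coincide on an open neighbourhood of `p`. -/
def germCon (p : X) : RingCon (CPlus X) where
  r f g := ∃ U : Set X, IsOpen U ∧ p ∈ U ∧ ∀ x ∈ U, f x = g x
  iseqv :=
    { refl := fun _ => ⟨Set.univ, isOpen_univ, trivial, fun _ _ => rfl⟩
      symm := fun ⟨U, hU, hp, h⟩ => ⟨U, hU, hp, fun x hx => (h x hx).symm⟩
      trans := fun ⟨U, hU, hp, h⟩ ⟨V, hV, hq, k⟩ =>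
        ⟨U ∩ V, hU.inter hV, ⟨hp, hq⟩, fun x hx => (h x hx.1).trans (k x hx.2)⟩ }
  add' := by
    rintro f f' g g' ⟨U, hU, hp, h⟩ ⟨V, hV, hq, k⟩
    refine ⟨U ∩ V, hU.inter hV, ⟨hp, hq⟩,
      eqOn_of_dense (hU.inter hV) (dense_finSet₂ f g) fun x hx => ?_⟩
    obtain ⟨a, ha⟩ := exists_of_mem_finSet hx.2.1
    obtain ⟨b, hb⟩ := exists_of_mem_finSet hx.2.2
    rw [add_apply ha hb, add_apply ((h x hx.1.1).symm.trans ha) ((k x hx.1.2).symm.trans hb)]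
  mul' := by
    rintro f f' g g' ⟨U, hU, hp, h⟩ ⟨V, hV, hq, k⟩
    refine ⟨U ∩ V, hU.inter hV, ⟨hp, hq⟩,
      eqOn_of_dense (hU.inter hV) (dense_finSet₂ f g) fun x hx => ?_⟩
    obtain ⟨a, ha⟩ := exists_of_mem_finSet hx.2.1
    obtain ⟨b, hb⟩ := exists_of_mem_finSet hx.2.2
    rw [mul_apply ha hb, mul_apply ((h x hx.1.1).symm.trans ha) ((k x hx.1.2).symm.trans hb)]

/-- The ring of germs `C⁺(X)/p`. -/
abbrev GermRing (X : Type*) [TopologicalSpace X] [CompactSpace X] [T2Space X]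
    [ExtremallyDisconnected X] (p : X) : Type _ := (germCon p).Quotient

end Ring

end CPlus

/-!
The key fact is that polynomial equations can be solved already in `C⁺(X)`, before passing to germs:
if the leading coefficient of `a₀ + a₁ T + ⋯ + aₙ Tⁿ`, `n ≠ 0`, is nonzero on a dense set, then the
polynomial has a root in `C⁺(X)` (`CPlus.exists_root_of_dense_ne_zero`). On a dense set `D` all
coefficients are finite and the leading one does not vanish. Over `D` the pairs `(x, z)` with
`z` a root of the polynomial at `x` form a relation which is closed, because the coefficients are
continuous, and locally bounded, because roots are bounded in terms of the coefficients. The closure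
of this relation in `X × (ℂ ∪ {∞})` is a compact space mapping onto `X`. As `X` is extremally
disconnected, it is projective among compact Hausdorff spaces (Gleason), so this map has a
continuous section (`CPlus.exists_selection`). Over `D` the section still picks roots, and `D` is
dense, so it is a root in `C⁺(X)`.

Algebraic closedness of the ring of germs follows by lifting the coefficients of a monic polynomial.
For invertibility let the germ of `f` at `p` be nonzero. Then `p` lies in the clopen set
`closure {f ≠ 0}`. Changing `f` to `1` outside this set does not affect the germ and makes `f`
nonzero on a dense set, so that the linear equation `f T - 1 = 0` has a solution.
-/

namespace CPlus

open Filter Finset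

section Values

variable {X : Type*} [TopologicalSpace X]

/-- The value of `f` at `x` as a complex number, with the value `0` where `f` is infinite. -/
noncomputable def val (f : CPlus X) (x : X) : ℂ := (f x).elim 0 id

theorem val_eq {f : CPlus X} {x : X} {a : ℂ} (h : f x = (a : OnePoint ℂ)) : f.val x = a := by
  simp [val, h]

theorem coe_val {f : CPlus X} {x : X} (hx : x ∈ f.finSet) : (f.val x : OnePoint ℂ) = f x := by
  obtain ⟨a, ha⟩ := exists_of_mem_finSet hx
  rw [val_eq ha, ha]

theorem continuousAt_val {f : CPlus X} {x : X} (hx : x ∈ f.finSet) : ContinuousAt f.val x := by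
  rw [OnePoint.isOpenEmbedding_coe.isInducing.continuousAt_iff]
  refine f.cont.continuousAt.congr ?_
  filter_upwards [f.isOpen_finSet.mem_nhds hx] with y hy
  exact (coe_val hy).symm

theorem isOpen_ne_zero (f : CPlus X) : IsOpen {x | f x ≠ ((0 : ℂ) : OnePoint ℂ)} :=
  (isClosed_singleton.preimage f.cont).isOpen_compl

end Values

section PolynomialEquations

/-- A root of a polynomial of degree `n` is bounded by the norms of the coefficients. -/
theorem norm_le_of_sum_eq_zero {n : ℕ} {c : ℕ → ℂ} (hc : c n ≠ 0) {z : ℂ}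
    (hz : ∑ i ∈ range (n + 1), c i * z ^ i = 0) :
    ‖z‖ ≤ 1 + (∑ i ∈ range n, ‖c i‖) / ‖c n‖ := by
  have hpos : 0 < ‖c n‖ := norm_pos_iff.2 hc
  have hsum : 0 ≤ ∑ i ∈ range n, ‖c i‖ := sum_nonneg fun i _ => norm_nonneg _
  rcases le_total ‖z‖ 1 with h1 | h1
  · exact h1.trans (le_add_of_nonneg_right (by positivity))
  refine le_trans ?_ (le_add_of_nonneg_left zero_le_one)
  rw [le_div_iff₀ hpos]
  rcases n with _ | m
  · simp [hc] at hz
  rw [sum_range_succ, add_comm, add_eq_zero_iff_eq_neg] at hz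
  have h2 : ‖c (m + 1)‖ * ‖z‖ ^ (m + 1) ≤ (∑ i ∈ range (m + 1), ‖c i‖) * ‖z‖ ^ m := by
    rw [← norm_pow, ← norm_mul, hz, norm_neg, sum_mul]
    refine (norm_sum_le _ _).trans (sum_le_sum fun i hi => ?_)
    rw [norm_mul, norm_pow]
    gcongr
    · exact Nat.lt_succ_iff.1 (mem_range.1 hi)
  refine le_of_mul_le_mul_right ?_ (pow_pos (zero_lt_one.trans_le h1) m)
  calc ‖z‖ * ‖c (m + 1)‖ * ‖z‖ ^ m = ‖c (m + 1)‖ * ‖z‖ ^ (m + 1) := by ring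
    _ ≤ _ := h2

theorem exists_sum_eq_zero {n : ℕ} (hn : n ≠ 0) {c : ℕ → ℂ} (hc : c n ≠ 0) :
    ∃ z : ℂ, ∑ i ∈ range (n + 1), c i * z ^ i = 0 := by
  let P : Polynomial ℂ := ∑ i ∈ range (n + 1), Polynomial.C (c i) * Polynomial.X ^ i
  have hcoeff : P.coeff n = c n := by
    simp [P, Polynomial.finsetSum_coeff, Polynomial.coeff_C_mul, Polynomial.coeff_X_pow]
  have hdeg : P.degree ≠ 0 := by
    intro h
    have h1 : (n : WithBot ℕ) ≤ P.degree := Polynomial.le_degree_of_ne_zero (hcoeff ▸ hc)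
    rw [h] at h1
    exact hn (Nat.le_zero.1 (by exact_mod_cast h1))
  obtain ⟨z, hz⟩ := IsAlgClosed.exists_root P hdeg
  exact ⟨z, by simpa [P, Polynomial.IsRoot, Polynomial.eval_finsetSum] using hz⟩

variable {X : Type*} [TopologicalSpace X] [CompactSpace X] [T2Space X] [ExtremallyDisconnected X]

/-- A relation between `X` and `ℂ` which over a dense set `D` is total, closed and locally bounded
has a selection on `D` that extends to an element of `C⁺(X)`. Local boundedness keeps the closure
of the relation in `X × (ℂ ∪ {∞})` away from `∞` over `D`. -/
theorem exists_selection {D : Set X} (hD : Dense D) {R : Set (X × ℂ)}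
    (htotal : ∀ x ∈ D, ∃ z, (x, z) ∈ R) (hclosed : ∀ q ∈ closure R, q.1 ∈ D → q ∈ R)
    (hbdd : ∀ x ∈ D, ∃ C : ℝ, ∀ᶠ y in 𝓝 x, ∀ z, (y, z) ∈ R → ‖z‖ ≤ C) :
    ∃ g : CPlus X, ∀ x ∈ D, ∃ z : ℂ, g x = (z : OnePoint ℂ) ∧ (x, z) ∈ R := by
  let e : X × ℂ → X × OnePoint ℂ := Prod.map id (fun z => (z : OnePoint ℂ))
  have he : Topology.IsInducing e :=
    Topology.IsInducing.id.prodMap OnePoint.isOpenEmbedding_coe.isInducing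
  let S : Set (X × OnePoint ℂ) := e '' R
  have hS : ∀ q ∈ closure S, q.1 ∈ D → ∃ z : ℂ, q.2 = (z : OnePoint ℂ) ∧ (q.1, z) ∈ R := by
    rintro ⟨x, w⟩ hq hx
    have hw : w ≠ ∞ := by
      rintro rfl
      obtain ⟨C, hC⟩ := hbdd x hx
      have hV : ((fun z : ℂ => (z : OnePoint ℂ)) '' Metric.closedBall 0 C)ᶜ ∈
          𝓝 (∞ : OnePoint ℂ) :=
        (OnePoint.isOpen_compl_image_coe.2
          ⟨Metric.isClosed_closedBall, isCompact_closedBall 0 C⟩).mem_nhds (by simp)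
      obtain ⟨_, ⟨hy, hz⟩, ⟨y, z⟩, hR, rfl⟩ :=
        mem_closure_iff_nhds.1 hq _ (prod_mem_nhds hC hV)
      exact hz ⟨z, by simpa using hy z hR, rfl⟩
    obtain ⟨z, rfl⟩ := OnePoint.ne_infty_iff_exists.1 hw
    refine ⟨z, rfl, hclosed (x, z) ?_ hx⟩
    rw [he.closure_eq_preimage_closure_image]
    exact hq
  have hcomp : CompactSpace (closure S) := isCompact_iff_compactSpace.1 isClosed_closure.isCompact
  have hsurj : Function.Surjective fun q : closure S => q.1.1 := by
    have hr : IsClosed (Set.range fun q : closure S => q.1.1) :=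
      (isCompact_range (continuous_fst.comp continuous_subtype_val)).isClosed
    have hDr : D ⊆ Set.range fun q : closure S => q.1.1 := fun x hx => by
      obtain ⟨z, hz⟩ := htotal x hx
      exact ⟨⟨(x, z), subset_closure ⟨(x, z), hz, rfl⟩⟩, rfl⟩
    intro x
    exact hr.closure_subset_iff.2 hDr (hD x)
  obtain ⟨s, hsc, hs⟩ := CompactT2.ExtremallyDisconnected.projective (A := X)
    continuous_id (continuous_fst.comp continuous_subtype_val) hsurj
  have hs' : ∀ x, (s x).1.1 = x := fun x => congrFun hs x
  let m : C(X, OnePoint ℂ) := ⟨fun x => (s x).1.2, by fun_prop⟩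
  have hm : ∀ x ∈ D, ∃ z : ℂ, m x = (z : OnePoint ℂ) ∧ (x, z) ∈ R := by
    intro x hx
    have := hS (s x).1 (s x).2 (by rwa [hs'])
    rwa [hs'] at this
  refine ⟨⟨m, ?_⟩, hm⟩
  rw [(isClosed_singleton.preimage m.continuous).isNowhereDense_iff,
    interior_eq_empty_iff_dense_compl]
  refine hD.mono fun x hx hx' => ?_
  obtain ⟨z, hz, -⟩ := hm x hx
  exact OnePoint.coe_ne_infty z (hz.symm.trans hx')

theorem pow_apply {f : CPlus X} {x : X} {a : ℂ} (ha : f x = (a : OnePoint ℂ)) (n : ℕ) :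
    (f ^ n) x = (a ^ n : ℂ) := by
  induction n with
  | zero => simpa using one_apply x
  | succ n ih => rw [pow_succ, pow_succ, mul_apply ih ha]

theorem sum_apply {ι : Type*} {s : Finset ι} {f : ι → CPlus X} {x : X} {a : ι → ℂ}
    (h : ∀ i ∈ s, f i x = (a i : OnePoint ℂ)) : (∑ i ∈ s, f i) x = (∑ i ∈ s, a i : ℂ) := by
  classical
  induction s using Finset.induction_on with
  | empty => simpa using zero_apply x
  | insert i s hi ih =>
    rw [sum_insert hi, sum_insert hi]
    exact add_apply (h i (mem_insert_self i s)) (ih fun j hj => h j (mem_insert_of_mem hj))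

/-- A nonconstant polynomial over `C⁺(X)` whose leading coefficient is nonzero on a dense set has a
root in `C⁺(X)`. -/
theorem exists_root_of_dense_ne_zero {n : ℕ} (hn : n ≠ 0) (a : ℕ → CPlus X)
    (ha : Dense {x | a n x ≠ ((0 : ℂ) : OnePoint ℂ)}) :
    ∃ g : CPlus X, ∑ i ∈ range (n + 1), a i * g ^ i = 0 := by
  let D : Set X := {x | a n x ≠ ((0 : ℂ) : OnePoint ℂ)} ∩ ⋂ i, (a i).finSet
  -- A compact Hausdorff space is Baire, so intersecting over all `i : ℕ` keeps density.
  have hD : Dense D := ha.inter_of_isOpen_left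
    (dense_iInter_of_isOpen (fun i => (a i).isOpen_finSet) fun i => (a i).dense_finSet)
    (isOpen_ne_zero _)
  have hfin : ∀ x ∈ D, ∀ i, x ∈ (a i).finSet := fun x hx i => Set.mem_iInter.1 hx.2 i
  have hlead : ∀ x ∈ D, (a n).val x ≠ 0 := fun x hx h0 =>
    hx.1 (by rw [← coe_val (hfin x hx n), h0])
  let F : X × ℂ → ℂ := fun q => ∑ i ∈ range (n + 1), (a i).val q.1 * q.2 ^ i
  have hF : ∀ q : X × ℂ, q.1 ∈ D → ContinuousAt F q := fun q hq =>
    tendsto_finsetSum _ fun i _ =>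
      (ContinuousAt.comp (continuousAt_val (hfin _ hq i)) continuousAt_fst).mul
        (continuousAt_snd.pow i)
  let R : Set (X × ℂ) := {q | F q = 0}
  obtain ⟨g, hg⟩ := exists_selection hD (R := R)
    (fun x hx => exists_sum_eq_zero hn (c := fun i => (a i).val x) (hlead x hx))
    (fun q hq hqD => by
      have : (𝓝[R] q).NeBot := mem_closure_iff_nhdsWithin_neBot.1 hq
      refine tendsto_nhds_unique (l := 𝓝[R] q)
        ((hF q hqD).tendsto.mono_left nhdsWithin_le_nhds) (tendsto_const_nhds.congr' ?_)
      filter_upwards [self_mem_nhdsWithin] with r hr using hr.symm)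
    (fun x hx => by
      let B : X → ℝ := fun y => 1 + (∑ i ∈ range n, ‖(a i).val y‖) / ‖(a n).val y‖
      have hB : ContinuousAt B x := continuousAt_const.add
        (ContinuousAt.div (tendsto_finsetSum _ fun i _ => (continuousAt_val (hfin x hx i)).norm)
          (continuousAt_val (hfin x hx n)).norm (norm_ne_zero_iff.2 (hlead x hx)))
      refine ⟨B x + 1, ?_⟩
      filter_upwards [hB.eventually_lt continuousAt_const (lt_add_one (B x)),
        (continuousAt_val (hfin x hx n)).eventually_ne (hlead x hx)] with y hy hy0 z hz
      exact (norm_le_of_sum_eq_zero (c := fun i => (a i).val y) hy0 hz).trans hy.le)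
  refine ⟨g, ext_of_dense hD fun x hx => ?_⟩
  obtain ⟨z, hz, hR⟩ := hg x hx
  rw [sum_apply fun i _ => mul_apply (coe_val (hfin x hx i)).symm (pow_apply hz i), zero_apply]
  exact congrArg _ hR

end PolynomialEquations

section Germs

variable {X : Type*} [TopologicalSpace X] [CompactSpace X] [T2Space X] [ExtremallyDisconnected X]

/-- If the germ of `f` at `p` is nonzero, then some `h` with the same germ is invertible: `h` agrees
with `f` on the clopen set `closure {f ≠ 0}` and is `1` elsewhere. -/
theorem exists_germ_eq_and_mul_eq_one {f : CPlus X} {p : X} (hf : ¬ germCon p f 0) :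
    ∃ h g : CPlus X, germCon p f h ∧ h * g = 1 := by
  classical
  let W : Set X := closure {x | f x ≠ ((0 : ℂ) : OnePoint ℂ)}
  have hW : IsClopen W :=
    ⟨isClosed_closure, ExtremallyDisconnected.open_closure _ (isOpen_ne_zero f)⟩
  have hzero : ∀ x ∉ W, f x = ((0 : ℂ) : OnePoint ℂ) := fun x hx =>
    not_not.1 fun h0 => hx (subset_closure h0)
  have hp : p ∈ W := by
    by_contra hp
    exact hf ⟨Wᶜ, hW.compl.isOpen, hp, fun x hx => hzero x hx⟩
  let m : X → OnePoint ℂ := W.piecewise f (fun _ => ((1 : ℂ) : OnePoint ℂ))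
  have hmW : ∀ x ∈ W, m x = f x := fun x hx => Set.piecewise_eq_of_mem _ _ _ hx
  have hmW' : ∀ x ∉ W, m x = ((1 : ℂ) : OnePoint ℂ) := fun x hx =>
    Set.piecewise_eq_of_notMem _ _ _ hx
  have hm : Continuous m := f.cont.piecewise (by simp [hW.frontier_eq]) continuous_const
  have hnd : IsNowhereDense (m ⁻¹' {(∞ : OnePoint ℂ)}) := by
    refine f.nowhereDense_infty.mono fun x hx => ?_
    by_cases hxW : x ∈ W
    · exact (hmW x hxW).symm.trans hx
    · exact absurd ((hmW' x hxW).symm.trans hx) (OnePoint.coe_ne_infty 1)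
  let h : CPlus X := ⟨⟨m, hm⟩, hnd⟩
  have hdense : Dense {x | h x ≠ ((0 : ℂ) : OnePoint ℂ)} := by
    intro x
    by_cases hxW : x ∈ W
    · refine closure_mono (fun y hy => ?_) hxW
      exact fun h0 => hy ((hmW y (subset_closure hy)).symm.trans h0)
    · refine subset_closure fun h0 => ?_
      have h1 := (hmW' x hxW).symm.trans h0
      simp at h1
  obtain ⟨g, hg⟩ := exists_root_of_dense_ne_zero one_ne_zero (fun i => if i = 0 then -1 else h)
    (by simpa using hdense)
  refine ⟨h, g, ⟨W, hW.isOpen, hp, fun x hx => (hmW x hx).symm⟩, ?_⟩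
  rw [sum_range_succ, sum_range_one] at hg
  exact (neg_add_eq_zero.1 (by simpa using hg)).symm

theorem isField_germRing (p : X) : IsField (GermRing X p) where
  exists_pair_ne := by
    refine ⟨0, 1, fun h => ?_⟩
    obtain ⟨U, -, hp, hU⟩ := (RingCon.eq (germCon p)).1 h
    have h1 := hU p hp
    rw [zero_apply, one_apply, OnePoint.coe_eq_coe] at h1
    exact zero_ne_one h1
  mul_comm := mul_comm
  mul_inv_cancel := by
    intro a ha
    obtain ⟨f, rfl⟩ := (germCon p).mk'_surjective a
    obtain ⟨h, g, hfh, hg⟩ := exists_germ_eq_and_mul_eq_one (f := f) (p := p) fun h0 =>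
      ha ((RingCon.eq (germCon p)).2 h0)
    refine ⟨(germCon p).mk' g, ?_⟩
    have hfh' : (germCon p).mk' f = (germCon p).mk' h := (RingCon.eq (germCon p)).2 hfh
    rw [hfh', ← map_mul, hg, map_one]

/-- Every field that is a quotient of `C⁺(X)` is algebraically closed. -/
theorem isAlgClosed_of_surjective {K : Type*} [Field K] (φ : CPlus X →+* K)
    (hφ : Function.Surjective φ) : IsAlgClosed K := by
  classical
  refine IsAlgClosed.of_exists_root K fun P hP hirr => ?_
  choose b hb using fun i => hφ (P.coeff i)
  obtain ⟨g, hg⟩ := exists_root_of_dense_ne_zero hirr.natDegree_pos.ne'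
    (fun i => if i = P.natDegree then 1 else b i)
    (by simp [one_apply])
  refine ⟨φ g, ?_⟩
  rw [Polynomial.eval_eq_sum_range, ← map_zero φ, ← hg, map_sum]
  refine sum_congr rfl fun i _ => ?_
  rw [map_mul, map_pow]
  congr 1
  split_ifs with hi
  · rw [hi, hP.coeff_natDegree, map_one]
  · exact (hb i).symm

end Germs

end CPlus

theorem mainTheorem5 (X : Type*) [TopologicalSpace X] [CompactSpace X] [T2Space X]
    [ExtremallyDisconnected X] (p : X) :
    ∃ h : IsField (CPlus.GermRing X p),
      letI : Field (CPlus.GermRing X p) := h.toField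
      IsAlgClosed (CPlus.GermRing X p) := by
  refine ⟨CPlus.isField_germRing p, ?_⟩
  let _ : Field (CPlus.GermRing X p) := (CPlus.isField_germRing p).toField
  exact CPlus.isAlgClosed_of_surjective (CPlus.germCon p).mk' (CPlus.germCon p).mk'_surjective
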